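/- **Conventions.** For a commutative ring $R$, an $R$-functor is a covariant functor from commutative $R$-algebras to sets; schemes over $R$ are identified with their functors of points. For an $R$-group functor $\mathbf G$ acting on an $R$-functor $\mathbf X$ and subfunctors $\mathbf Y,\mathbf Z\subseteq\mathbf X$, the *strict transporter* $T_{\mathbf G}(\mathbf Y,\mathbf Z)$ is the subfunctor of $\mathbf G$ given by $$T_{\mathbf G}(\mathbf Y,\mathbf Z)(S)=\{g\in\mathbf G(S)\mid g_{S'}\cdot\mathbf Y(S')=\mathbf Z(S')\text{ for every }S\text{-algebra }S'\},$$ where $g_{S'}$ denotes the image of $g$ in $\mathbf G(S')$. Let $A$ be an Artinian local ring with algebraically closed residue field $k$. Either $\operatorname{char}A=p^{m+1}$ for a prime $p$ and an integer $m\ge 0$, or $\operatorname{char}A=0$, in which case put $m=0$ and let $p$ be any prime. Let $W_m$ denote the ring functor of $p$-typical Witt vectors truncated to the components $0,\dots,m$ (so $W_0(R)=R$). Regard $A$ as a $W_m(k)$-algebra through a ring homomorphism $W_m(k)\to A$ whose composite with $A\to k$ is the projection $W_m(k)\to k$ to the component $0$ (if $\operatorname{char}A>0$ there is exactly one; if $\operatorname{char}A=0$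 it amounts to the choice of a coefficient field, and any choice is allowed). The *Greenberg functor* $\mathcal F$ sends an $A$-functor $\mathbf X$ to the $k$-functor $$(\mathcal F\mathbf X)(R)=\mathbf X\bigl(A\otimes_{W_m(k)}W_m(R)\bigr).$$ It sends group functors to group functors, actions to actions, and subfunctors of $\mathbf X$ to subfunctors of $\mathcal F\mathbf X$. **Theorem.** Let $\mathbf G$ be an affine group scheme of finite type over $A$, acting on an affine scheme $\mathbf X$ of finite type over $A$, and let $\mathbf Y$ and $\mathbf Z$ be closed subschemes of $\mathbf X$ which are smooth over $A$ and whose fibres $\mathbf Y_k$ and $\mathbf Z_k$ are reduced. Let $\mathcal F\mathbf G$ act on $\mathcal F\mathbf X$ via the action induced from that of $\mathbf G$ on $\mathbf X$. Assume that $T_{\mathbf G}(\mathbf Y,\mathbf Z)$ is representable by a closed subscheme of $\mathbf G$ which is smooth over $A$. Then $$\mathcal F\,T_{\mathbf G}(\mathbf Y,\mathbf Z)=T_{\mathcal F\mathbf G}(\mathcal F\mathbf Y,\mathcal F\mathbf Z)$$ as subfunctors of $\mathcal F\mathbf G$. -/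

import Mathlib

open CategoryTheory
open scoped TensorProduct

universe u

noncomputable section

/-! ### Functors over a ring: affine schemes, closed subschemes, smoothness, fibres -/

/-- `R`-functors: covariant functors from commutative `R`-algebras to sets. -/
abbrev AlgFunctor (R : Type u) [CommRing R] := CommAlgCat.{u} R ⥤ Type u

/-- `R`-group functors: the sets of points carry group structures, functorially. -/
abbrev GroupFunctor (R : Type u) [CommRing R] := CommAlgCat.{u} R ⥤ GrpCat.{u}

/-- The underlying `R`-functor of an `R`-group functor. -/
abbrev GroupFunctor.points {R : Type u} [CommRing R] (G : GroupFunctor R) : AlgFunctor R :=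
  G ⋙ forget GrpCat.{u}

/-- `X` is an affine scheme of finite type over `R`: it is represented by a finitely generated
`R`-algebra. -/
def IsAffineFiniteType {R : Type u} [CommRing R] (X : AlgFunctor R) : Prop :=
  ∃ B : CommAlgCat.{u} R, Algebra.FiniteType R B ∧ Nonempty (X.CorepresentableBy B)

/-- `X` is a smooth affine scheme over `R`: it is represented by a smooth (that is, formally
smooth and finitely presented) `R`-algebra. -/
def IsSmoothAffine {R : Type u} [CommRing R] (X : AlgFunctor R) : Prop :=
  ∃ B : CommAlgCat.{u} R, Algebra.Smooth R B ∧ Nonempty (X.CorepresentableBy B)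

/-- `X` is a reduced affine scheme over `R`: it is represented by a reduced `R`-algebra. -/
def IsReducedAffine {R : Type u} [CommRing R] (X : AlgFunctor R) : Prop :=
  ∃ B : CommAlgCat.{u} R, IsReduced B ∧ Nonempty (X.CorepresentableBy B)

/-- `Y ⊆ X` is a closed subfunctor: for every point `x ∈ X(S)`, viewed as a morphism from
`Spec S` to `X`, the preimage of `Y` is the closed subscheme of `Spec S` cut out by an ideal.
For an affine scheme `X` these are exactly the closed subschemes of `X`. -/
def IsClosedSubfunctor {R : Type u} [CommRing R] {X : AlgFunctor R} (Y : Subfunctor X) : Prop :=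
  ∀ (S : CommAlgCat.{u} R) (x : X.obj S), ∃ I : Ideal S,
    ∀ (S' : CommAlgCat.{u} R) (f : S ⟶ S'),
      X.map f x ∈ Y.obj S' ↔ ∀ a ∈ I, f a = 0

/-- An `R'`-algebra viewed as an `R`-algebra, for an `R`-algebra `R'`. -/
def restrictAlg (R R' : Type u) [CommRing R] [CommRing R'] [Algebra R R'] :
    CommAlgCat.{u} R' ⥤ CommAlgCat.{u} R where
  obj S :=
    letI : Algebra R S := Algebra.compHom S (algebraMap R R')
    CommAlgCat.of R S
  map {S T} f :=
    letI : Algebra R S := Algebra.compHom S (algebraMap R R')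
    letI : Algebra R T := Algebra.compHom T (algebraMap R R')
    CommAlgCat.ofHom
      { f.hom.toRingHom with
        commutes' := fun r => f.hom.commutes (algebraMap R R' r) }

/-- The base extension `X_{R'}` of an `R`-functor `X`: its points in an `R'`-algebra `S` are
the points of `X` in `S` viewed as an `R`-algebra. -/
abbrev AlgFunctor.baseExt {R : Type u} [CommRing R] (X : AlgFunctor R)
    (R' : Type u) [CommRing R'] [Algebra R R'] : AlgFunctor R' :=
  restrictAlg R R' ⋙ X

/-! ### Group actions and strict transporters -/

/-- An action of an `R`-group functor `G` on an `R`-functor `X`: a morphism `G × X ⟶ X` which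
for every `R`-algebra `S` is an action of the group `G(S)` on the set `X(S)`. -/
structure GroupFunctorAction {R : Type u} [CommRing R] (G : GroupFunctor R) (X : AlgFunctor R) where
  smul : ∀ S : CommAlgCat.{u} R, G.obj S → X.obj S → X.obj S
  one_smul : ∀ (S : CommAlgCat.{u} R) (x : X.obj S), smul S 1 x = x
  mul_smul : ∀ (S : CommAlgCat.{u} R) (g h : G.obj S) (x : X.obj S),
    smul S (g * h) x = smul S g (smul S h x)
  naturality : ∀ {S S' : CommAlgCat.{u} R} (f : S ⟶ S') (g : G.obj S) (x : X.obj S),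
    X.map f (smul S g x) = smul S' (G.map f g) (X.map f x)

/-- The strict transporter from `Y` to `Z`: its `S`-points are the `g ∈ G(S)` such that, for every
map of `R`-algebras `S ⟶ S'`, the action of the image of `g` in `G(S')` maps `Y(S')` onto
`Z(S')`. -/
def strictTransporter {R : Type u} [CommRing R] {G : GroupFunctor R} {X : AlgFunctor R}
    (α : GroupFunctorAction G X) (Y Z : Subfunctor X) : Subfunctor G.points where
  obj S := {g : G.obj S | ∀ (S' : CommAlgCat.{u} R) (f : S ⟶ S'),
    α.smul S' (G.map f g) '' Y.obj S' = Z.obj S'}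
  map {S T} i g hg S' f := by
    have h := hg S' (i ≫ f)
    rw [G.map_comp] at h
    exact h

/-! ### The Greenberg functor -/

/-- The ring homomorphism `W_n(R) → W_n(S)` on truncated Witt vectors of length `n` (with
components `0, …, n - 1`) given by applying a ring homomorphism `R → S` to the components. -/
def wittMap (p : ℕ) [Fact p.Prime] (n : ℕ) {R S : Type*} [CommRing R] [CommRing S] (f : R →+* S) :
    TruncatedWittVector p n R →+* TruncatedWittVector p n S :=
  have key : ∀ w : WittVector p R,
      TruncatedWittVector.mk p (fun i => f ((WittVector.truncate n w).coeff i)) =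
        WittVector.truncate n (WittVector.map f w) := fun w => by
    ext i
    simp [WittVector.coeff_truncate, TruncatedWittVector.coeff_mk, WittVector.map_coeff]
  { toFun := fun x => TruncatedWittVector.mk p (fun i => f (x.coeff i))
    map_one' := by rw [← map_one (WittVector.truncate n), key, map_one, map_one]
    map_zero' := by rw [← map_zero (WittVector.truncate n), key, map_zero, map_zero]
    map_mul' := fun x y => by
      obtain ⟨x, rfl⟩ := WittVector.truncate_surjective p n R x
      obtain ⟨y, rfl⟩ := WittVector.truncate_surjective p n R y
      rw [← map_mul, key, key, key, map_mul, map_mul]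
    map_add' := fun x y => by
      obtain ⟨x, rfl⟩ := WittVector.truncate_surjective p n R x
      obtain ⟨y, rfl⟩ := WittVector.truncate_surjective p n R y
      rw [← map_add, key, key, key, map_add, map_add] }

theorem wittMap_coeff (p : ℕ) [Fact p.Prime] (n : ℕ) {R S : Type*} [CommRing R] [CommRing S]
    (f : R →+* S) (x : TruncatedWittVector p n R) (i : Fin n) :
    (wittMap p n f x).coeff i = f (x.coeff i) :=
  TruncatedWittVector.coeff_mk _ _

/-- For a `k`-algebra `R`, the ring `W_n(R)` as a `W_n(k)`-algebra. -/
abbrev wittAlgebra (p : ℕ) [Fact p.Prime] (n : ℕ) (k R : Type u) [CommRing k] [CommRing R]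
    [Algebra k R] : Algebra (TruncatedWittVector p n k) (TruncatedWittVector p n R) :=
  (wittMap p n (algebraMap k R)).toAlgebra

/-- Given a `W_n(k)`-algebra structure `φ : W_n(k) → A` on the ring `A`, the functor
`R ↦ A ⊗_{W_n(k)} W_n(R)` from `k`-algebras to `A`-algebras. -/
def greenbergRing {p : ℕ} [Fact p.Prime] {n : ℕ} {A k : Type u} [CommRing A] [CommRing k]
    (φ : TruncatedWittVector p n k →+* A) : CommAlgCat.{u} k ⥤ CommAlgCat.{u} A where
  obj R :=
    letI := φ.toAlgebra
    letI := wittAlgebra p n k R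
    CommAlgCat.of A (A ⊗[TruncatedWittVector p n k] TruncatedWittVector p n R)
  map {R S} f :=
    letI := φ.toAlgebra
    letI := wittAlgebra p n k R
    letI := wittAlgebra p n k S
    CommAlgCat.ofHom (Algebra.TensorProduct.map (AlgHom.id A A)
      { wittMap p n f.hom.toRingHom with
        commutes' := fun w => TruncatedWittVector.ext fun i =>
          (wittMap_coeff p n _ _ i).trans <|
            (congrArg f.hom (wittMap_coeff p n (algebraMap k R) w i)).trans <|
              (f.hom.commutes (w.coeff i)).trans
                (wittMap_coeff p n (algebraMap k S) w i).symm })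
  map_id R := by
    let _ := φ.toAlgebra
    let _ := wittAlgebra p n k R
    apply CommAlgCat.hom_ext
    apply Algebra.TensorProduct.ext'
    intro a w
    refine (Algebra.TensorProduct.map_tmul _ _ a w).trans ?_
    refine congrArg (fun v => a ⊗ₜ[TruncatedWittVector p n k] v) ?_
    exact TruncatedWittVector.ext fun i => wittMap_coeff p n _ w i
  map_comp {R S T} f g := by
    let _ := φ.toAlgebra
    let _ := wittAlgebra p n k R
    let _ := wittAlgebra p n k S
    let _ := wittAlgebra p n k T
    apply CommAlgCat.hom_ext
    apply Algebra.TensorProduct.ext'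
    intro a w
    refine (Algebra.TensorProduct.map_tmul _ _ a w).trans ?_
    refine congrArg (fun v => a ⊗ₜ[TruncatedWittVector p n k] v) ?_
    refine TruncatedWittVector.ext fun i => (wittMap_coeff p n _ w i).trans ?_
    exact ((wittMap_coeff p n _ _ i).trans (congrArg g.hom (wittMap_coeff p n _ w i))).symm

/-- The Greenberg functor on `A`-functors: `(𝓕 X)(R) = X(A ⊗_{W_n(k)} W_n(R))`. -/
abbrev greenberg {p : ℕ} [Fact p.Prime] {n : ℕ} {A k : Type u} [CommRing A] [CommRing k]
    (φ : TruncatedWittVector p n k →+* A) (X : AlgFunctor A) : AlgFunctor k :=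
  greenbergRing φ ⋙ X

/-- The Greenberg functor on `A`-group functors. -/
abbrev greenbergGroup {p : ℕ} [Fact p.Prime] {n : ℕ} {A k : Type u} [CommRing A] [CommRing k]
    (φ : TruncatedWittVector p n k →+* A) (G : GroupFunctor A) : GroupFunctor k :=
  greenbergRing φ ⋙ G

/-- The Greenberg functor on subfunctors: `𝓕 Y` as a subfunctor of `𝓕 X`, for `Y ⊆ X`. -/
def greenbergSub {p : ℕ} [Fact p.Prime] {n : ℕ} {A k : Type u} [CommRing A] [CommRing k]
    (φ : TruncatedWittVector p n k →+* A) {X : AlgFunctor A} (Y : Subfunctor X) :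
    Subfunctor (greenberg φ X) where
  obj R := Y.obj ((greenbergRing φ).obj R)
  map i := Y.map ((greenbergRing φ).map i)

/-- The action of `𝓕 G` on `𝓕 X` induced by an action of `G` on `X`. -/
def greenbergAction {p : ℕ} [Fact p.Prime] {n : ℕ} {A k : Type u} [CommRing A] [CommRing k]
    (φ : TruncatedWittVector p n k →+* A) {G : GroupFunctor A} {X : AlgFunctor A}
    (α : GroupFunctorAction G X) : GroupFunctorAction (greenbergGroup φ G) (greenberg φ X) where
  smul R := α.smul ((greenbergRing φ).obj R)
  one_smul R := α.one_smul ((greenbergRing φ).obj R)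
  mul_smul R := α.mul_smul ((greenbergRing φ).obj R)
  naturality f := α.naturality ((greenbergRing φ).map f)

end

/-! One inclusion holds because the Greenberg condition tests only some of the algebras tested by
the transporter over `A`. Conversely, let `P = A ⊗ W_m(R)`. It is enough that `g • Y(P) = Z(P)` for
this single `P`: the same equality then follows over every `P`-algebra
(`image_smul_eq_of_image_smul_eq`).

Let `B` represent `Y`. The condition that `g` moves the universal point of `Y` over `P ⊗ B` into `Z`
is cut out by an ideal `I`. Every `A`-point of `Y` gives a `P`-point, so the corresponding
evaluation `P ⊗ B → P` kills `I`. These evaluations are jointly injective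
(`eq_zero_of_tensorEval_eq_zero`), so `I = 0`. Joint injectivity combines density of `k`-points in
the reduced fibre, smooth lifting of `k`-points to `A`-points, and dévissage along powers of the
maximal ideal. -/

theorem eq_zero_of_forall_algHom_eq_zero {k C : Type*} [Field k] [IsAlgClosed k] [CommRing C]
    [Algebra k C] [Algebra.FiniteType k C] [IsReduced C] {c : C}
    (hc : ∀ ψ : C →ₐ[k] k, ψ c = 0) : c = 0 := by
  have : IsJacobsonRing C := isJacobsonRing_of_finiteType (A := k)
  have hbot : (⊥ : Ideal C).jacobson = ⊥ := by
    rw [← Ideal.radical_eq_jacobson]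
    exact nilradical_eq_zero C
  rw [← Ideal.mem_bot, ← hbot, Ideal.jacobson, Ideal.mem_sInf]
  rintro I ⟨-, hI⟩
  let _ : Field (C ⧸ I) := Ideal.Quotient.field I
  -- By the Nullstellensatz each residue field is `k`, so reduction modulo `I` is one of the points
  -- `ψ`.
  have : Module.Finite k (C ⧸ I) := finite_of_finite_type_of_isJacobsonRing k (C ⧸ I)
  have hbij : Function.Bijective (Algebra.ofId k (C ⧸ I)) :=
    IsAlgClosed.algebraMap_bijective_of_isIntegral
  let e : k ≃ₐ[k] (C ⧸ I) := AlgEquiv.ofBijective _ hbij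
  have h := hc (e.symm.toAlgHom.comp (Ideal.Quotient.mkₐ k I))
  rw [← Ideal.Quotient.eq_zero_iff_mem]
  exact e.symm.map_eq_zero_iff.mp h

/-! ### Detecting tensors by `A`-points -/

section Evaluation

variable {A B : Type*} [CommRing A] [CommRing B] [Algebra A B]

/-- Evaluation of an element of `M ⊗ B` at an `A`-point of `B`. -/
noncomputable def tensorEval (M : Type*) [AddCommGroup M] [Module A M] (y : B →ₐ[A] A) :
    M ⊗[A] B →ₗ[A] M :=
  (TensorProduct.rid A M).toLinearMap ∘ₗ y.toLinearMap.lTensor M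

@[simp]
theorem tensorEval_tmul {M : Type*} [AddCommGroup M] [Module A M] (y : B →ₐ[A] A) (x : M) (b : B) :
    tensorEval M y (x ⊗ₜ b) = y b • x := by
  simp [tensorEval]

theorem tensorEval_rTensor {M N : Type*} [AddCommGroup M] [Module A M] [AddCommGroup N]
    [Module A N] (f : M →ₗ[A] N) (y : B →ₐ[A] A) (z : M ⊗[A] B) :
    tensorEval N y (f.rTensor B z) = f (tensorEval M y z) := by
  induction z with
  | zero => simp
  | tmul x b => simp
  | add z w hz hw => simp only [map_add, hz, hw]

variable [IsLocalRing A] [IsArtinianRing A]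

/-- The maximal ideal of an Artinian local ring is nilpotent, so infinitesimal lifting applies to `A
→ k`. -/
theorem exists_algHom_residue_eq [Algebra.FormallySmooth A B]
    (ψ : B →ₐ[A] IsLocalRing.ResidueField A) :
    ∃ y : B →ₐ[A] A, ∀ b, IsLocalRing.residue A (y b) = ψ b := by
  have hnil : IsNilpotent (RingHom.ker
      (Algebra.ofId A (IsLocalRing.ResidueField A) : A →+* IsLocalRing.ResidueField A)) := by
    have : RingHom.ker (Algebra.ofId A (IsLocalRing.ResidueField A) :
        A →+* IsLocalRing.ResidueField A) = IsLocalRing.maximalIdeal A :=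
      IsLocalRing.ker_residue
    rw [this]
    exact (isArtinianRing_iff_isNilpotent_maximalIdeal A).mp ‹_›
  have hsurj : Function.Surjective (Algebra.ofId A (IsLocalRing.ResidueField A)) :=
    IsLocalRing.residue_surjective
  exact ⟨Algebra.FormallySmooth.liftOfSurjective ψ _ hsurj hnil, fun b =>
    Algebra.FormallySmooth.liftOfSurjective_apply ψ _ hsurj hnil b⟩

variable [IsAlgClosed (IsLocalRing.ResidueField A)] [Algebra.FormallySmooth A B]
  [Algebra.FiniteType A B] [IsReduced (IsLocalRing.ResidueField A ⊗[A] B)]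

/-- Coordinates in a `k`-basis of `V` reduce to `V = k`. There `k ⊗ B` is reduced, so its `k`-points
detect zero, and each of them lifts to an `A`-point of `B`. -/
theorem eq_zero_of_tensorEval_eq_zero_of_residueField (V : Type*) [AddCommGroup V] [Module A V]
    [Module (IsLocalRing.ResidueField A) V] [IsScalarTower A (IsLocalRing.ResidueField A) V]
    (z : V ⊗[A] B) (hz : ∀ y : B →ₐ[A] A, tensorEval V y z = 0) : z = 0 := by
  classical
  set k := IsLocalRing.ResidueField A
  let b := Module.Basis.ofVectorSpace k V
  let e : V ≃ₗ[A] (_ →₀ k) := b.repr.restrictScalars A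
  let E := (e.rTensor B).trans (TensorProduct.finsuppLeft A A k B _)
  rw [← E.map_eq_zero_iff]
  ext i
  let c : V →ₗ[A] k := Finsupp.lapply i ∘ₗ e.toLinearMap
  have hE : E z i = c.rTensor B z := by
    simp only [E, LinearEquiv.trans_apply, TensorProduct.finsuppLeft_apply, c,
      LinearMap.rTensor_comp_apply]
    rfl
  rw [hE, Finsupp.zero_apply]
  refine eq_zero_of_forall_algHom_eq_zero (k := k) fun ψ => ?_
  obtain ⟨y, hy⟩ := exists_algHom_residue_eq
    ((ψ.restrictScalars A).comp Algebra.TensorProduct.includeRight)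
  -- The point `ψ` is `k`-linear, hence determined by its values on `1 ⊗ b`, which are the residues
  -- of `y b`.
  have key : ∀ w : k ⊗[A] B, ψ w = tensorEval k y w := fun w => by
    induction w with
    | zero => simp
    | tmul a b =>
      have h1 : a ⊗ₜ[A] b = a • ((1 : k) ⊗ₜ[A] b) := by simp [TensorProduct.smul_tmul']
      have h2 : ψ (1 ⊗ₜ b) = algebraMap A k (y b) := (hy b).symm
      rw [tensorEval_tmul, h1, map_smul, h2, Algebra.smul_def (y b) a, smul_eq_mul, mul_comm]
    | add z w hz hw => simp only [map_add, hz, hw]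
  rw [key, tensorEval_rTensor, hz, map_zero]

/-- Dévissage along `𝔪M ⊆ M`: the quotient `M / 𝔪M` is a `k`-vector space, and `𝔪M` is killed by one
power of `𝔪` fewer. Only right exactness of the tensor product is used. -/
theorem eq_zero_of_tensorEval_eq_zero_of_pow_smul (n : ℕ) (M : Type*) [AddCommGroup M] [Module A M]
    (hM : IsLocalRing.maximalIdeal A ^ n • (⊤ : Submodule A M) = ⊥)
    (z : M ⊗[A] B) (hz : ∀ y : B →ₐ[A] A, tensorEval M y z = 0) : z = 0 := by
  induction n generalizing M with
  | zero =>
    have : Subsingleton M := by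
      rw [← Submodule.subsingleton_iff A, ← subsingleton_iff_bot_eq_top]
      simpa using hM.symm
    exact Subsingleton.elim _ _
  | succ n ih =>
    let N : Submodule A M := IsLocalRing.maximalIdeal A • ⊤
    have hquot : N.mkQ.rTensor B z = 0 := by
      have hN : Module.IsTorsionBySet A (M ⧸ N) (IsLocalRing.maximalIdeal A) :=
        Module.isTorsionBySet_quotient_ideal_smul M (IsLocalRing.maximalIdeal A)
      let _ : Module (IsLocalRing.ResidueField A) (M ⧸ N) := hN.module
      have : IsScalarTower A (IsLocalRing.ResidueField A) (M ⧸ N) := hN.isScalarTower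
      refine eq_zero_of_tensorEval_eq_zero_of_residueField _ _ fun y => ?_
      rw [tensorEval_rTensor, hz, map_zero]
    have hexact : Function.Exact (N.subtype.rTensor B) (N.mkQ.rTensor B) :=
      rTensor_exact B (LinearMap.exact_subtype_mkQ N) N.mkQ_surjective
    obtain ⟨w, rfl⟩ := (hexact z).mp hquot
    -- Evaluations of the lift `w` lie in `N` and vanish in `M`, hence vanish in `N`, although `N ⊗
    -- B → M ⊗ B` is not known to be injective.
    rw [ih N ?_ w ?_, map_zero]
    · apply Submodule.map_injective_of_injective N.injective_subtype
      rw [Submodule.map_smul'', Submodule.map_top, Submodule.range_subtype, Submodule.map_bot,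
        ← hM, pow_succ, Submodule.mul_smul]
    · intro y
      have h := hz y
      rw [tensorEval_rTensor] at h
      exact N.injective_subtype (by simpa using h)

/-- For a smooth `B` with reduced closed fibre, the `A`-points of `B` jointly detect the elements
of `M ⊗ B`, for every `A`-module `M`. -/
theorem eq_zero_of_tensorEval_eq_zero (M : Type*) [AddCommGroup M] [Module A M]
    (z : M ⊗[A] B) (hz : ∀ y : B →ₐ[A] A, tensorEval M y z = 0) : z = 0 := by
  obtain ⟨n, hn⟩ := (isArtinianRing_iff_isNilpotent_maximalIdeal A).mp ‹_›
  refine eq_zero_of_tensorEval_eq_zero_of_pow_smul n M ?_ z hz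
  rw [hn, Submodule.zero_eq_bot, Submodule.bot_smul]

end Evaluation

/-! ### Base extension and reducedness of the fibre -/

/-- Extension of scalars is left adjoint to restriction of scalars. -/
noncomputable def restrictAlgHomEquiv {R : Type u} [CommRing R] (R' : Type u) [CommRing R']
    [Algebra R R'] (B : CommAlgCat.{u} R) (S : CommAlgCat.{u} R') :
    (CommAlgCat.of R' (R' ⊗[R] B) ⟶ S) ≃ (B ⟶ (restrictAlg R R').obj S) :=
  letI : Algebra R S := Algebra.compHom S (algebraMap R R')
  haveI : IsScalarTower R R' S := .of_algebraMap_eq fun _ => rfl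
  let E : (R' ⊗[R] B →ₐ[R'] S) ≃ (B →ₐ[R] S) := (AlgHom.liftEquiv R R' B S).symm
  { toFun := fun f => CommAlgCat.ofHom (E f.hom)
    invFun := fun g => CommAlgCat.ofHom (E.symm g.hom)
    left_inv := fun f => CommAlgCat.hom_ext (E.symm_apply_apply f.hom)
    right_inv := fun g => CommAlgCat.hom_ext (E.apply_symm_apply g.hom) }

theorem restrictAlgHomEquiv_comp {R : Type u} [CommRing R] (R' : Type u) [CommRing R']
    [Algebra R R'] (B : CommAlgCat.{u} R) {S T : CommAlgCat.{u} R'}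
    (f : CommAlgCat.of R' (R' ⊗[R] B) ⟶ S) (g : S ⟶ T) :
    restrictAlgHomEquiv R' B T (f ≫ g) =
      restrictAlgHomEquiv R' B S f ≫ (restrictAlg R R').map g :=
  rfl

/-- The base extension of an affine scheme is represented by the tensor product. -/
noncomputable def baseExtCorepresentableBy {R : Type u} [CommRing R] {X : AlgFunctor R}
    {B : CommAlgCat.{u} R} (e : X.CorepresentableBy B) (R' : Type u) [CommRing R'] [Algebra R R'] :
    (X.baseExt R').CorepresentableBy (CommAlgCat.of R' (R' ⊗[R] B)) where
  homEquiv {S} := (restrictAlgHomEquiv R' B S).trans e.homEquiv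
  homEquiv_comp {S _} g f :=
    (congrArg e.homEquiv (restrictAlgHomEquiv_comp R' B f g)).trans <|
      e.homEquiv_comp ((restrictAlg R R').map g) (restrictAlgHomEquiv R' B S f)

theorem isReduced_tensorProduct_of_isReducedAffine_baseExt {R : Type u} [CommRing R]
    {X : AlgFunctor R} {B : CommAlgCat.{u} R} (e : X.CorepresentableBy B) (R' : Type u)
    [CommRing R'] [Algebra R R'] (h : IsReducedAffine (X.baseExt R')) : IsReduced (R' ⊗[R] B) := by
  obtain ⟨C, hC, ⟨e'⟩⟩ := h
  let i := CommAlgCat.algEquivOfIso ((baseExtCorepresentableBy e R').uniqueUpToIso e')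
  exact isReduced_of_injective i i.injective

/-! ### From `P`-points to all points -/

/-- A natural transformation out of `X_P` carrying the `P`-points of a smooth `Y` with reduced
fibre into a closed `Z` carries all of `Y_P` into `Z`. -/
theorem Subfunctor.map_mem_of_forall_mem {A : Type u} [CommRing A] [IsLocalRing A]
    [IsArtinianRing A] [IsAlgClosed (IsLocalRing.ResidueField A)] {X : AlgFunctor A}
    {Y Z : Subfunctor X} (hZ : IsClosedSubfunctor Z) (hY : IsSmoothAffine Y.toFunctor)
    (hYred : IsReducedAffine (AlgFunctor.baseExt Y.toFunctor (IsLocalRing.ResidueField A)))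
    (P : CommAlgCat.{u} A) (σ : ∀ (S : CommAlgCat.{u} A), (P ⟶ S) → X.obj S → X.obj S)
    (hσ : ∀ (S T : CommAlgCat.{u} A) (f : P ⟶ S) (h : S ⟶ T) (x : X.obj S),
      X.map h (σ S f x) = σ T (f ≫ h) (X.map h x))
    (hP : ∀ y ∈ Y.obj P, σ P (𝟙 P) y ∈ Z.obj P)
    (S : CommAlgCat.{u} A) (f : P ⟶ S) (y : X.obj S) (hy : y ∈ Y.obj S) : σ S f y ∈ Z.obj S := by
  obtain ⟨B, hB, ⟨e⟩⟩ := hY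
  have := isReduced_tensorProduct_of_isReducedAffine_baseExt e _ hYred
  let Q : CommAlgCat.{u} A := CommAlgCat.of A (P ⊗[A] B)
  let jP : P ⟶ Q := CommAlgCat.ofHom Algebra.TensorProduct.includeLeft
  let jB : B ⟶ Q := CommAlgCat.ofHom Algebra.TensorProduct.includeRight
  -- The universal point of `Y` over `Q = P ⊗ B`; by `hd`, every `σ T f (e.homEquiv b).1` is a
  -- specialization of `σ Q jP u.1`.
  let u := e.homEquiv jB
  let d (T : CommAlgCat.{u} A) (f : P ⟶ T) (b : B ⟶ T) : Q ⟶ T :=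
    CommAlgCat.ofHom (Algebra.TensorProduct.productMap f.hom b.hom)
  have hdP (T f b) : jP ≫ d T f b = f := by
    apply CommAlgCat.hom_ext
    exact Algebra.TensorProduct.productMap_left _ _
  have hdB (T f b) : jB ≫ d T f b = b := by
    apply CommAlgCat.hom_ext
    exact Algebra.TensorProduct.productMap_right _ _
  have hd (T f b) : X.map (d T f b) (σ Q jP u.1) = σ T f (e.homEquiv b).1 := by
    have h1 : e.homEquiv b = Y.toFunctor.map (d T f b) u := by
      rw [← e.homEquiv_comp, hdB]
    rw [hσ, hdP, h1]
    rfl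
  obtain ⟨I, hI⟩ := hZ Q (σ Q jP u.1)
  have hI0 : ∀ a ∈ I, a = 0 := by
    intro a ha
    refine eq_zero_of_tensorEval_eq_zero (A := A) (B := B) P a fun y => ?_
    -- The `A`-point `y` viewed as a `P`-point of `Y`. By `hP` its image lies in `Z`, so its
    -- specialization map `Q ⟶ P`, which is evaluation at `y`, kills `I`.
    let b : B ⟶ P := CommAlgCat.ofHom ((Algebra.ofId A P).comp y)
    have h : d P (𝟙 P) b a = 0 := by
      refine (hI P (d P (𝟙 P) b)).mp ?_ a ha
      rw [hd]
      exact hP _ (e.homEquiv b).2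
    have key : ∀ w : P ⊗[A] B,
        tensorEval P y w = Algebra.TensorProduct.productMap (AlgHom.id A P) b.hom w := fun w => by
      induction w with
      | zero => simp
      | tmul a c => simp [b, Algebra.smul_def, mul_comm, Algebra.ofId_apply]
      | add z w hz hw => simp only [map_add, hz, hw]
    exact (key a).trans h
  let b := e.homEquiv.symm ⟨y, hy⟩
  have h := (hI S (d S f b)).mpr fun a ha => by rw [hI0 a ha, map_zero]
  rw [hd] at h
  have hb : (e.homEquiv b).1 = y := congrArg Subtype.val (e.homEquiv.apply_symm_apply ⟨y, hy⟩)
  exact hb ▸ h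

/-- Containment spreads from `P` to every `P`-algebra: apply this to `g` from `Y` to `Z`, and to
`g⁻¹` from `Z` to `Y`. This symmetry is why both subfunctors must be closed and smooth with reduced
fibre. -/
theorem image_smul_eq_of_image_smul_eq {A : Type u} [CommRing A] [IsLocalRing A] [IsArtinianRing A]
    [IsAlgClosed (IsLocalRing.ResidueField A)] {G : GroupFunctor A} {X : AlgFunctor A}
    (α : GroupFunctorAction G X) {Y Z : Subfunctor X}
    (hYclosed : IsClosedSubfunctor Y) (hZclosed : IsClosedSubfunctor Z)
    (hYsmooth : IsSmoothAffine Y.toFunctor) (hZsmooth : IsSmoothAffine Z.toFunctor)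
    (hYred : IsReducedAffine (AlgFunctor.baseExt Y.toFunctor (IsLocalRing.ResidueField A)))
    (hZred : IsReducedAffine (AlgFunctor.baseExt Z.toFunctor (IsLocalRing.ResidueField A)))
    (P : CommAlgCat.{u} A) (g : G.obj P) (hg : α.smul P g '' Y.obj P = Z.obj P) :
    g ∈ (strictTransporter α Y Z).obj P := by
  have hinv (S : CommAlgCat.{u} A) (h : G.obj S) (x : X.obj S) :
      α.smul S h⁻¹ (α.smul S h x) = x := by
    rw [← α.mul_smul, inv_mul_cancel, α.one_smul]
  have hinv' (S : CommAlgCat.{u} A) (h : G.obj S) (x : X.obj S) :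
      α.smul S h (α.smul S h⁻¹ x) = x := by
    rw [← α.mul_smul, mul_inv_cancel, α.one_smul]
  have hnat (g : G.obj P) (S T : CommAlgCat.{u} A) (f : P ⟶ S) (h : S ⟶ T) (x : X.obj S) :
      X.map h (α.smul S (G.map f g) x) = α.smul T (G.map (f ≫ h) g) (X.map h x) := by
    rw [α.naturality, G.map_comp]
    rfl
  intro S f
  apply Set.Subset.antisymm
  · rintro _ ⟨y, hy, rfl⟩
    refine Subfunctor.map_mem_of_forall_mem hZclosed hYsmooth hYred P
      (fun S f => α.smul S (G.map f g)) (hnat g) (fun y hy => ?_) S f y hy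
    rw [G.map_id, ← hg]
    exact ⟨y, hy, rfl⟩
  · intro z hz
    refine ⟨α.smul S (G.map f g)⁻¹ z, ?_, hinv' _ _ _⟩
    rw [← map_inv]
    refine Subfunctor.map_mem_of_forall_mem hYclosed hZsmooth hZred P
      (fun S f => α.smul S (G.map f g⁻¹)) (hnat g⁻¹) (fun z hz => ?_) S f z hz
    rw [← hg] at hz
    obtain ⟨y, hy, rfl⟩ := hz
    rw [G.map_id]
    exact (hinv P g y).symm ▸ hy

theorem mainTheorem4
    (A : Type u) [CommRing A] [IsLocalRing A] [IsArtinianRing A]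
    [IsAlgClosed (IsLocalRing.ResidueField A)]
    (p m : ℕ) [Fact p.Prime] (hchar : CharP A (p ^ (m + 1)) ∨ (CharP A 0 ∧ m = 0))
    (φ : TruncatedWittVector p (m + 1) (IsLocalRing.ResidueField A) →+* A)
    (hφ : ∀ w, IsLocalRing.residue A (φ w) = w.coeff 0)
    (G : GroupFunctor A) (hG : IsAffineFiniteType G.points)
    (X : AlgFunctor A) (hX : IsAffineFiniteType X)
    (α : GroupFunctorAction G X)
    (Y Z : Subfunctor X)
    (hYclosed : IsClosedSubfunctor Y) (hZclosed : IsClosedSubfunctor Z)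
    (hYsmooth : IsSmoothAffine Y.toFunctor) (hZsmooth : IsSmoothAffine Z.toFunctor)
    (hYred : IsReducedAffine
      (AlgFunctor.baseExt Y.toFunctor (IsLocalRing.ResidueField A)))
    (hZred : IsReducedAffine
      (AlgFunctor.baseExt Z.toFunctor (IsLocalRing.ResidueField A)))
    (hTclosed : IsClosedSubfunctor (strictTransporter α Y Z))
    (hTsmooth : IsSmoothAffine (strictTransporter α Y Z).toFunctor) :
    greenbergSub φ (strictTransporter α Y Z) =
      strictTransporter (greenbergAction φ α) (greenbergSub φ Y) (greenbergSub φ Z) := by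
  apply Subfunctor.ext
  funext R
  apply Set.Subset.antisymm
  · intro g hg R' f
    exact hg _ ((greenbergRing φ).map f)
  · intro g hg
    refine image_smul_eq_of_image_smul_eq α hYclosed hZclosed hYsmooth hZsmooth hYred hZred
      ((greenbergRing φ).obj R) g ?_
    -- Only the transport equality over `R` itself is needed.
    have h := hg R (𝟙 R)
    rw [(greenbergGroup φ G).map_id] at h
    exact h
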